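/- All algebras are over $\mathbb{C}$. For a Banach algebra $A$, an element $a\in A$ is \emph{compact} if the operator $x\mapsto axa$ on $A$ is compact, and $K(A)$ denotes the set of compact elements of $A$. A \emph{uniform algebra} is a commutative Banach algebra $A$ (not necessarily unital) with $\|a^2\|=\|a\|^2$ for all $a\in A$. For a commutative Banach algebra $A$, the \emph{multiplier algebra} $M(A)$ is the algebra of all bounded linear operators $T:A\to A$ with $T(ab)=aT(b)$ for all $a,b\in A$, with composition as product and the operator norm; if $A$ is an abelian C$^*$-algebra, $M(A)$ carries the involution $T^*(a)=(T(a^*))^*$. \textbf{Theorem.} (i) Let $A$ be a separable non-unital uniform algebra with $K(A)=\{0\}$. Then there exist a subalgebra $D\subseteq\ell_\infty$ and an isometric algebra isomorphism of $M(A)$ onto $D$ such that $D\cap c_0=\{0\}$. (ii) Let $A$ be a separable abelian C$^*$-algebra (unital or not) with $K(A)=\{0\}$. Then there exist a $^*$-subalgebra $D\subseteq\ell_\infty$ and an isometric $^*$-isomorphism of $M(A)$ onto $D$ such that $D\cap c_0=\{0\}$. Here $\ell_\infty$ is the C$^*$-algebra of bounded complex sequences indexed by $\mathbb{N}$ with pointwise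 operations and the supremum norm, $c_0\subseteq\ell_\infty$ is the ideal of sequences converging to $0$, and in neither part is $D$ required to contain the unit of $\ell_\infty$. -/

import Mathlib

open Filter Topology
open scoped ENNReal

/-- The complex Banach algebra `ℓ∞` of bounded complex sequences: pointwise operations,
supremum norm, pointwise conjugation as involution. -/
abbrev EllInfty : Type := lp (fun _ : ℕ => ℂ) ∞

/-- `c₀`, the subspace of `ℓ∞` of sequences that converge to `0`. -/
def cZero : Submodule ℂ EllInfty where
  carrier := {x | Tendsto (fun n => x n) atTop (𝓝 0)}
  zero_mem' := by simp
  add_mem' := by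
    intro x y hx hy
    simpa using Tendsto.add hx hy
  smul_mem' := by
    intro c x hx
    simpa using Tendsto.const_smul hx c

/-- `K(A)`: the set of compact elements of `A`, those `a` for which the operator
`x ↦ a * x * a` on `A` is compact. -/
def compactElements (A : Type*) [NonUnitalNormedRing A] : Set A :=
  {a | IsCompactOperator (fun x : A => a * x * a)}

/-- A (not necessarily unital) complex Banach algebra is a uniform algebra if it is commutative and
`‖a²‖ = ‖a‖²` for all `a`; commutativity, completeness and the complex structure are carried by the
instances. -/
def IsUniformAlgebra (A : Type*) [NonUnitalNormedCommRing A] [NormedSpace ℂ A]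
    [SMulCommClass ℂ A A] [IsScalarTower ℂ A A] [CompleteSpace A] : Prop :=
  ∀ a : A, ‖a * a‖ = ‖a‖ ^ 2

/-- `A` has a unit element. -/
def HasUnit (A : Type*) [NonUnitalNormedCommRing A] : Prop :=
  ∃ e : A, ∀ a : A, e * a = a

/-- The multiplier algebra `M(A)` of a commutative complex Banach algebra: the bounded operators `T`
on `A` with `T (a * b) = a * T b`, with composition as product and with the operator norm. -/
def multiplierAlgebra (A : Type*) [NonUnitalNormedCommRing A] [NormedSpace ℂ A]
    [SMulCommClass ℂ A A] : Subalgebra ℂ (A →L[ℂ] A) where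
  carrier := {T | ∀ a b : A, T (a * b) = a * T b}
  mul_mem' := by
    intro S T hS hT a b
    change ∀ a b : A, _ at hS hT
    simp [hS, hT]
  add_mem' := by
    intro S T hS hT a b
    change ∀ a b : A, _ at hS hT
    simp [hS, hT, mul_add]
  algebraMap_mem' := by
    intro c a b
    simp [Algebra.algebraMap_eq_smul_one, mul_smul_comm]

namespace multiplierAlgebra

variable {A : Type*} [NonUnitalCommCStarAlgebra A]

/-- The involution of `M(A)` for an abelian C⋆-algebra `A`: `T⋆ a = (T a⋆)⋆`. It extends the
involution of `A`, since `z⋆ * a = (z * a⋆)⋆`. -/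
noncomputable instance instStar : Star (multiplierAlgebra A) where
  star T :=
    ⟨(((starₗᵢ ℂ : A ≃ₗᵢ⋆[ℂ] A) : A →L⋆[ℂ] A).comp (T : A →L[ℂ] A)).comp
      ((starₗᵢ ℂ : A ≃ₗᵢ⋆[ℂ] A) : A →L⋆[ℂ] A), by
      intro a b
      have h := T.2 (star a) (star b)
      change star ((T : A →L[ℂ] A) (star (a * b))) = a * star ((T : A →L[ℂ] A) (star b))
      rw [star_mul, mul_comm (star b), h, star_mul, star_star, mul_comm]⟩

theorem star_apply (T : multiplierAlgebra A) (a : A) :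
    (star T : multiplierAlgebra A).1 a = star (T.1 (star a)) := rfl

end multiplierAlgebra

/-! In a uniform algebra the spectral radius equals the norm, so every `a` has a contractive
character `φ` with `‖φ a‖ = ‖a‖` (`exists_character_norm_eq`). Where `φ a ≠ 0`, `T ↦ φ (T a) / φ a`
extends `φ` to a contractive character of `M(A)`. Taking such characters for a dense sequence in `A`
gives a homomorphism into `ℓ∞`, isometric by `norm_le_norm_evalSeq`. Each coordinate is repeated
infinitely often, so an image sequence tending to `0` vanishes. In the C⋆ case characters preserve
`star`, hence so do their extensions. -/

namespace IsUniformAlgebra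

variable {A : Type*} [NonUnitalNormedCommRing A] [NormedSpace ℂ A] [SMulCommClass ℂ A A]
  [IsScalarTower ℂ A A] [CompleteSpace A]

/-- The `L¹` unitization of a commutative normed algebra is a commutative normed ring. -/
noncomputable abbrev unitizationNormedCommRing (A : Type*) [NonUnitalNormedCommRing A]
    [NormedSpace ℂ A] [SMulCommClass ℂ A A] [IsScalarTower ℂ A A] :
    NormedCommRing (WithLp 1 (Unitization ℂ A)) :=
  { WithLp.instUnitizationNormedRing with
    mul_comm := fun x y => WithLp.ofLp_injective 1 (mul_comm (WithLp.ofLp x) (WithLp.ofLp y)) }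

theorem norm_toLp_inr_pow_two_pow (hA : IsUniformAlgebra A) (a : A) (n : ℕ) :
    ‖(WithLp.toLp 1 (a : Unitization ℂ A)) ^ 2 ^ n‖ = ‖a‖ ^ 2 ^ n := by
  suffices ∃ b : A, (WithLp.toLp 1 (a : Unitization ℂ A)) ^ 2 ^ n =
      WithLp.toLp 1 (b : Unitization ℂ A) ∧ ‖b‖ = ‖a‖ ^ 2 ^ n by
    obtain ⟨b, hb, hn⟩ := this
    rw [hb, WithLp.unitization_norm_inr, hn]
  induction n with
  | zero => exact ⟨a, by simp, by simp⟩
  | succ n ih =>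
    obtain ⟨b, hb, hn⟩ := ih
    refine ⟨b * b, ?_, ?_⟩
    · rw [pow_succ, pow_mul, hb, sq]
      apply WithLp.ofLp_injective 1
      simp
    · rw [hA b, hn, ← pow_mul, pow_succ]

/-- Along the exponents `2 ^ n`, the sequence in Gelfand's formula is constantly `‖a‖`. -/
theorem spectralRadius_toLp_inr (hA : IsUniformAlgebra A) (a : A) :
    spectralRadius ℂ (WithLp.toLp 1 (a : Unitization ℂ A)) = ‖a‖₊ := by
  have h := (spectrum.pow_nnnorm_pow_one_div_tendsto_nhds_spectralRadius
    (WithLp.toLp 1 (a : Unitization ℂ A))).comp (tendsto_pow_atTop_atTop_of_one_lt one_lt_two)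
  refine tendsto_nhds_unique h ?_
  refine tendsto_const_nhds.congr fun n => ?_
  have hn : ‖(WithLp.toLp 1 (a : Unitization ℂ A)) ^ 2 ^ n‖₊ = ‖a‖₊ ^ 2 ^ n :=
    Subtype.ext (by simpa using hA.norm_toLp_inr_pow_two_pow a n)
  rw [Function.comp_apply, hn, ENNReal.coe_pow, ← ENNReal.rpow_natCast, ← ENNReal.rpow_mul]
  simp

/-- The norm of an element of a uniform algebra is attained at a contractive character. -/
theorem exists_character_norm_eq (hA : IsUniformAlgebra A) (a : A) :
    ∃ φ : A →ₙₐ[ℂ] ℂ, (∀ x, ‖φ x‖ ≤ ‖x‖) ∧ ‖φ a‖ = ‖a‖ := by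
  let _ := unitizationNormedCommRing A
  have : NormOneClass (WithLp 1 (Unitization ℂ A)) := ⟨by
    rw [WithLp.unitization_norm_def]
    change ‖(1 : Unitization ℂ A).fst‖ + ‖(1 : Unitization ℂ A).snd‖ = 1
    simp⟩
  have : Nontrivial (WithLp 1 (Unitization ℂ A)) := NormOneClass.nontrivial
  obtain ⟨z, hz, hza⟩ :=
    spectrum.exists_nnnorm_eq_spectralRadius (WithLp.toLp 1 (a : Unitization ℂ A))
  rw [hA.spectralRadius_toLp_inr] at hza
  obtain ⟨f, rfl⟩ := WeakDual.CharacterSpace.mem_spectrum_iff_exists.mp hz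
  let g : WithLp 1 (Unitization ℂ A) →ₐ[ℂ] ℂ := WeakDual.CharacterSpace.toAlgHom f
  -- `Unitization.lift.symm` restricts the character of the unitization to `A`.
  refine ⟨Unitization.lift.symm
    (g.comp (WithLp.unitizationAlgEquiv ℂ).symm.toAlgHom), fun x => ?_, ?_⟩
  · exact (AlgHom.norm_apply_le_self g (WithLp.toLp 1 (x : Unitization ℂ A))).trans_eq
      (WithLp.unitization_norm_inr x)
  · exact congrArg NNReal.toReal (ENNReal.coe_injective hza)

end IsUniformAlgebra

theorem NonUnitalCommCStarAlgebra.isUniformAlgebra (A : Type*) [NonUnitalCommCStarAlgebra A] :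
    IsUniformAlgebra A := by
  intro a
  have h : ‖a * a‖ ^ 2 = (‖a‖ ^ 2) ^ 2 := by
    have h₁ : star (a * a) * (a * a) = star (star a * a) * (star a * a) := by
      simp only [star_mul, star_star]
      exact mul_mul_mul_comm _ _ _ _
    rw [sq ‖a * a‖, ← CStarRing.norm_star_mul_self, h₁, CStarRing.norm_star_mul_self,
      CStarRing.norm_star_mul_self]
    ring
  exact (pow_left_inj₀ (norm_nonneg _) (by positivity) two_ne_zero).mp h

/-- Characters of abelian C⋆-algebras preserve the involution. -/
theorem NonUnitalAlgHom.map_star_of_cstarAlgebra {A : Type*} [NonUnitalCommCStarAlgebra A]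
    (φ : A →ₙₐ[ℂ] ℂ) (a : A) : φ (star a) = star (φ a) := by
  have := AlgHomClass.instStarHomClass (F := Unitization ℂ A →ₐ[ℂ] ℂ) (A := Unitization ℂ A)
  simpa using map_star (Unitization.lift φ) (a : Unitization ℂ A)

namespace multiplierAlgebra

section Evaluation

variable {A : Type*} [NonUnitalNormedCommRing A] [NormedSpace ℂ A] [SMulCommClass ℂ A A]

/-- By commutativity `a * T b = T a * b`. Hence the ratio `φ (T a) / φ a` is the same for all `a`
with `φ a ≠ 0`. -/
theorem map_character_mul (φ : A →ₙₐ[ℂ] ℂ) (T : multiplierAlgebra A) (a b : A) :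
    φ a * φ (T.1 b) = φ (T.1 a) * φ b := by
  rw [← map_mul, ← map_mul, ← T.2 a b, mul_comm a b, T.2 b a, mul_comm]

/-- The extension of a character `φ` of `A` to the multiplier algebra, given by
`T ↦ φ (T a) / φ a`. It vanishes identically if `φ a = 0`. -/
noncomputable def evalAt (φ : A →ₙₐ[ℂ] ℂ) (a : A) : multiplierAlgebra A →ₙₐ[ℂ] ℂ where
  toFun T := φ (T.1 a) / φ a
  map_smul' c T := by
    change φ (c • T.1 a) / φ a = c • (φ (T.1 a) / φ a)
    rw [map_smul, smul_eq_mul, smul_eq_mul, mul_div_assoc]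
  map_zero' := by
    change φ 0 / φ a = 0
    simp
  map_add' S T := by
    change φ (S.1 a + T.1 a) / φ a = _
    rw [map_add, add_div]
  map_mul' S T := by
    change φ (S.1 (T.1 a)) / φ a = φ (S.1 a) / φ a * (φ (T.1 a) / φ a)
    by_cases h : φ a = 0
    · simp [h]
    · have := map_character_mul φ S (T.1 a) a
      field_simp
      linear_combination -this

theorem evalAt_apply (φ : A →ₙₐ[ℂ] ℂ) (a : A) (T : multiplierAlgebra A) :
    evalAt φ a T = φ (T.1 a) / φ a := rfl

theorem norm_evalAt_le {φ : A →ₙₐ[ℂ] ℂ} {a : A} (hφ : ∀ x, ‖φ x‖ ≤ ‖x‖) (ha : ‖φ a‖ = ‖a‖)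
    (T : multiplierAlgebra A) : ‖evalAt φ a T‖ ≤ ‖T‖ := by
  rw [evalAt_apply, norm_div, ha]
  exact div_le_of_le_mul₀ (norm_nonneg _) (norm_nonneg _) ((hφ _).trans (T.1.le_opNorm a))

/-- The map `M(A) → ℓ∞` given by a sequence of characters of `A`, each of them extended to `M(A)`
and repeated infinitely often. -/
noncomputable def evalSeq (φ : ℕ → A →ₙₐ[ℂ] ℂ) (d : ℕ → A) (hφ : ∀ n x, ‖φ n x‖ ≤ ‖x‖)
    (hd : ∀ n, ‖φ n (d n)‖ = ‖d n‖) : multiplierAlgebra A →ₙₐ[ℂ] EllInfty where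
  toFun T := ⟨fun k => evalAt (φ k.unpair.2) (d k.unpair.2) T, memℓp_infty
    ⟨‖T‖, by rintro _ ⟨k, rfl⟩; exact norm_evalAt_le (hφ _) (hd _) T⟩⟩
  map_smul' c T := by ext k; exact (evalAt _ _).map_smul c T
  map_zero' := by ext k; exact (evalAt _ _).map_zero
  map_add' S T := by ext k; exact (evalAt _ _).map_add S T
  map_mul' S T := by ext k; exact (evalAt _ _).map_mul S T

variable {φ : ℕ → A →ₙₐ[ℂ] ℂ} {d : ℕ → A} (hφ : ∀ n x, ‖φ n x‖ ≤ ‖x‖)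
  (hd : ∀ n, ‖φ n (d n)‖ = ‖d n‖)

theorem evalSeq_apply (T : multiplierAlgebra A) (k : ℕ) :
    evalSeq φ d hφ hd T k = evalAt (φ k.unpair.2) (d k.unpair.2) T := rfl

theorem norm_evalSeq_le (T : multiplierAlgebra A) : ‖evalSeq φ d hφ hd T‖ ≤ ‖T‖ :=
  lp.norm_le_of_forall_le (norm_nonneg _) fun _ => norm_evalAt_le (hφ _) (hd _) T

theorem norm_evalAt_le_norm_evalSeq (T : multiplierAlgebra A) (n : ℕ) :
    ‖evalAt (φ n) (d n) T‖ ≤ ‖evalSeq φ d hφ hd T‖ := by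
  have := lp.norm_apply_le_norm ENNReal.top_ne_zero (evalSeq φ d hφ hd T) (Nat.pair 0 n)
  rwa [evalSeq_apply, Nat.unpair_pair] at this

theorem norm_le_norm_evalSeq (hdense : DenseRange d) (T : multiplierAlgebra A) :
    ‖T‖ ≤ ‖evalSeq φ d hφ hd T‖ := by
  refine ContinuousLinearMap.opNorm_le_bound T.1 (norm_nonneg _) fun a => ?_
  refine le_of_forall_pos_le_add fun ε hε => ?_
  -- The approximation is of `T a`, not `a`: `φ n` then nearly attains the norm of `T a`. The error
  -- `‖T a - d n‖` enters twice, hence `ε / 2`.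
  obtain ⟨n, hn⟩ := hdense.exists_dist_lt (T.1 a) (half_pos hε)
  rw [dist_eq_norm] at hn
  have h₂ : ‖d n‖ ≤ ‖evalSeq φ d hφ hd T‖ * ‖a‖ + ‖T.1 a - d n‖ := by
    -- In this case `d n = 0`, since `φ n` attains its norm.
    by_cases h : φ n (d n) = 0
    · rw [← hd n, h, norm_zero]
      positivity
    · have h₁ : φ n (T.1 a) = evalAt (φ n) (d n) T * φ n a := by
        rw [evalAt_apply, div_mul_eq_mul_div, eq_div_iff h, ← map_character_mul]
        ring
      calc ‖d n‖ = ‖φ n (T.1 a) - φ n (T.1 a - d n)‖ := by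
            rw [← map_sub, sub_sub_cancel, hd]
        _ ≤ ‖evalAt (φ n) (d n) T * φ n a‖ + ‖φ n (T.1 a - d n)‖ :=
            h₁ ▸ norm_sub_le _ _
        _ ≤ _ := by
            rw [norm_mul]
            gcongr
            · exact norm_evalAt_le_norm_evalSeq hφ hd T n
            · exact hφ n a
            · exact hφ n _
  have h₃ : ‖T.1 a‖ ≤ ‖d n‖ + ‖T.1 a - d n‖ := norm_le_norm_add_norm_sub' _ _
  linarith

theorem isometry_evalSeq (hdense : DenseRange d) : Isometry (evalSeq φ d hφ hd) :=
  AddMonoidHomClass.isometry_of_norm _ fun T =>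
    (norm_evalSeq_le hφ hd T).antisymm (norm_le_norm_evalSeq hφ hd hdense T)

/-- Every value recurs along the indices `Nat.pair m j` with `j` fixed, and a constant subsequence
of a null sequence is zero. -/
theorem evalSeq_eq_zero_of_mem_cZero {T : multiplierAlgebra A}
    (hT : evalSeq φ d hφ hd T ∈ cZero) : evalSeq φ d hφ hd T = 0 := by
  ext k
  have hpair : Tendsto (fun m => Nat.pair m k.unpair.2) atTop atTop :=
    tendsto_atTop_mono (fun m => Nat.left_le_pair m _) tendsto_id
  have h : Tendsto (fun m => evalSeq φ d hφ hd T (Nat.pair m k.unpair.2)) atTop (𝓝 0) :=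
    Tendsto.comp (show Tendsto (fun n => evalSeq φ d hφ hd T n) atTop (𝓝 0) from hT) hpair
  simp only [evalSeq_apply, Nat.unpair_pair] at h
  exact tendsto_nhds_unique tendsto_const_nhds h

end Evaluation

/-- The multiplier algebra of a separable uniform algebra embeds isometrically into `ℓ∞` by means
of characters of the algebra, with range meeting `c₀` only in `0`. -/
theorem exists_isometry_evalSeq {A : Type*} [NonUnitalNormedCommRing A] [NormedSpace ℂ A]
    [SMulCommClass ℂ A A] [IsScalarTower ℂ A A] [CompleteSpace A]
    [TopologicalSpace.SeparableSpace A] (hA : IsUniformAlgebra A) :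
    ∃ (φ : ℕ → A →ₙₐ[ℂ] ℂ) (d : ℕ → A) (hφ : ∀ n x, ‖φ n x‖ ≤ ‖x‖)
      (hd : ∀ n, ‖φ n (d n)‖ = ‖d n‖), Isometry (evalSeq φ d hφ hd) := by
  choose ψ hψ hψa using hA.exists_character_norm_eq
  exact ⟨fun n => ψ (TopologicalSpace.denseSeq A n), TopologicalSpace.denseSeq A,
    fun _ => hψ _, fun _ => hψa _,
    isometry_evalSeq _ _ (TopologicalSpace.denseRange_denseSeq A)⟩

theorem evalAt_star {A : Type*} [NonUnitalCommCStarAlgebra A] (φ : A →ₙₐ[ℂ] ℂ) (a : A)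
    (T : multiplierAlgebra A) : evalAt φ a (star T) = star (evalAt φ a T) := by
  rw [evalAt_apply, evalAt_apply, star_apply, φ.map_star_of_cstarAlgebra, star_div₀]
  by_cases h : φ a = 0
  · simp [h]
  -- `star T` involves `T (star a)`; `map_character_mul` exchanges it for `T a`.
  · rw [div_eq_div_iff h (star_ne_zero.mpr h), ← star_mul', mul_comm, map_character_mul,
      φ.map_star_of_cstarAlgebra, star_mul', star_star]

end multiplierAlgebra

theorem mainTheorem2 :
    (∀ (A : Type*) [NonUnitalNormedCommRing A] [NormedSpace ℂ A] [SMulCommClass ℂ A A]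
        [IsScalarTower ℂ A A] [CompleteSpace A] [TopologicalSpace.SeparableSpace A],
      IsUniformAlgebra A → ¬ HasUnit A → compactElements A = {0} →
        ∃ D : NonUnitalSubalgebra ℂ EllInfty,
          (∃ Φ : multiplierAlgebra A →ₙₐ[ℂ] EllInfty,
            Isometry Φ ∧ NonUnitalAlgHom.range Φ = D) ∧
          (D : Set EllInfty) ∩ (cZero : Set EllInfty) = {0}) ∧
    (∀ (A : Type*) [NonUnitalCommCStarAlgebra A] [TopologicalSpace.SeparableSpace A],
      compactElements A = {0} →
        ∃ D : NonUnitalStarSubalgebra ℂ EllInfty,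
          (∃ Φ : multiplierAlgebra A →⋆ₙₐ[ℂ] EllInfty,
            Isometry Φ ∧ NonUnitalStarAlgHom.range Φ = D) ∧
          (D : Set EllInfty) ∩ (cZero : Set EllInfty) = {0}) := by
  refine ⟨?_, ?_⟩
  · intro A _ _ _ _ _ _ hA _ _
    obtain ⟨φ, d, hφ, hd, hiso⟩ := multiplierAlgebra.exists_isometry_evalSeq hA
    refine ⟨_, ⟨_, hiso, rfl⟩, ?_⟩
    refine Set.eq_singleton_iff_unique_mem.mpr ⟨⟨zero_mem _, zero_mem _⟩, ?_⟩
    rintro _ ⟨⟨T, rfl⟩, hT⟩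
    exact multiplierAlgebra.evalSeq_eq_zero_of_mem_cZero hφ hd hT
  · intro A _ _ _
    obtain ⟨φ, d, hφ, hd, hiso⟩ := multiplierAlgebra.exists_isometry_evalSeq
      (NonUnitalCommCStarAlgebra.isUniformAlgebra A)
    let Φ : multiplierAlgebra A →⋆ₙₐ[ℂ] EllInfty :=
      { multiplierAlgebra.evalSeq φ d hφ hd with
        map_star' := fun T => by
          ext k
          exact multiplierAlgebra.evalAt_star _ _ T }
    refine ⟨_, ⟨Φ, hiso, rfl⟩, ?_⟩
    refine Set.eq_singleton_iff_unique_mem.mpr ⟨⟨zero_mem _, zero_mem _⟩, ?_⟩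
    rintro _ ⟨⟨T, rfl⟩, hT⟩
    exact multiplierAlgebra.evalSeq_eq_zero_of_mem_cZero hφ hd hT
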